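/- For $\lambda=(\lambda_A,\lambda_B,\lambda_C)$ with $\lambda_A,\lambda_B,\lambda_C>0$ and $\lambda_A+\lambda_B+\lambda_C=1$, let $T=T_\lambda:[0,1)\to[0,1)$ be the symmetric 3-interval exchange transformation (3-IET) with lengths $\lambda$, i.e. the one given by the permutation $\begin{pmatrix}A&B&C\\ C&B&A\end{pmatrix}$: \[ T(x)=\begin{cases}x+\lambda_B+\lambda_C,&0\le x<\lambda_A,\\ x+\lambda_C-\lambda_A,&\lambda_A\le x<\lambda_A+\lambda_B,\\ x-\lambda_A-\lambda_B,&\lambda_A+\lambda_B\le x<1.\end{cases} \] Let $f(x)=\cos(2\pi x)$ and let $T_f:[0,1)\times\mathbb{R}\to[0,1)\times\mathbb{R}$, $T_f(x,t)=(Tx,\,t+f(x))$, be the associated skew product. Then, for almost every $\lambda$ with respect to the two-dimensional Lebesgue measure on the simplex, $T_f$ is ergodic with respect to the product of Lebesgue measure on $[0,1)$ and Lebesgue measure on $\mathbb{R}$: it preserves this measure, and every measurable $T_f$-invariant set is null or has null complement. -/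

import Mathlib

open MeasureTheory Set

noncomputable section

namespace IET

/-- The left endpoint of the interval with label `a` when consecutive intervals of lengths `len`
are laid out from `0` in the order prescribed by the positions `pos`. -/
def leftEnd {A : Type*} [Fintype A] {d : ℕ} (len : A → ℝ) (pos : A ≃ Fin d) (a : A) : ℝ :=
  ∑ b with pos b < pos a, len b

/-- The interval `I_a` (closed on the left, open on the right) with label `a`. -/
def interval {A : Type*} [Fintype A] {d : ℕ} (len : A → ℝ) (pos : A ≃ Fin d) (a : A) : Set ℝ :=
  Ico (leftEnd len pos a) (leftEnd len pos a + len a)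

/-- The interval exchange transformation with lengths `len`, where `top` and `bot` are the orders of
the intervals before and after the exchange: the interval `I_a` of the top partition is translated
onto the interval with the same label of the bottom partition. It is a self-map of `[0, ∑ a, len a)`
when all lengths are positive; it is extended to `ℝ` by the identity, so that the complement of
that interval is invariant as well. -/
def iet {A : Type*} [Fintype A] {d : ℕ} (len : A → ℝ) (top bot : A ≃ Fin d) (x : ℝ) : ℝ :=
  x + ∑ a, (interval len top a).indicator
    (fun _ => leftEnd len bot a - leftEnd len top a) x

/-- The symmetric 3-IET: the permutation is `(A B C / C B A)`, with `A, B, C` labelled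
`0, 1, 2`. -/
def symmThreeIET (len : Fin 3 → ℝ) : ℝ → ℝ :=
  iet len (Equiv.refl (Fin 3)) Fin.revPerm

/-- The skew product `T_f (x, t) = (T x, t + f x)`. -/
def skewProduct (T f : ℝ → ℝ) (p : ℝ × ℝ) : ℝ × ℝ :=
  (T p.1, p.2 + f p.1)

end IET

end

/-! With `L = 1 + b` and `α = 1 - a`, the exchange is the map induced on `[0, 1)` by the rotation by
`α` on the circle of length `L`. Extending the cosine by `0` over `[1, L)` makes the detour outside
`[0, 1)` cost nothing in the fibre, so it suffices to show that the resulting extension of the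
rotation is ergodic (`ergodic_skewProduct_of_ergodic_realExtension`).

The extended cocycle jumps by one at `0` and at `1`. If `p / q` approximates `α / L` to within `ε /
q ^ 2`, an orbit of length `q` is nearly a progression of step `L / q`. The cosine has mean zero
over `[0, 1)`, so its sum sees only the counting error `m - q / L`, where `m` is the number of
progression points in `[0, 1)` and differs from `q / L` by at most one. If also `q / L` is close to
`c` modulo one, the sum is close to `-c` or `1 - c` off a small set, while the `q`-th iterate is
close to the identity (`isRigidEssentialValue_neg_or_one_sub`). For almost every parameter such `q`
exist for every `c` (`ae_forall_hasApproximation`).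

Such limiting values are vertical periods of every invariant set
(`measure_diff_translation_eq_zero`). Uncountably many periods generate a dense subgroup of `ℝ`, so
almost every fibre is null or conull, and ergodicity of the rotation concludes
(`ergodic_realExtension`). -/

open Filter Topology

/-! ### Small displacements and sets invariant under dense translations -/

/-- A measure preserving map that is close to the identity on `E` moves little of a set of finite
measure out of itself along `E`. -/
theorem exists_pos_forall_measure_inter_diff_preimage_le {Y : Type*} [PseudoMetricSpace Y]
    [T2Space Y] [MeasurableSpace Y] [BorelSpace Y] {μ : Measure Y} [μ.InnerRegularCompactLTTop] [μ.OuterRegular]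
    {D : Set Y} (hD : MeasurableSet D) (hμD : μ D ≠ ⊤) {η : ENNReal} (hη : η ≠ 0) :
    ∃ ε : ℝ, 0 < ε ∧ ∀ (Θ : Y → Y) (E : Set Y), MeasurePreserving Θ μ μ →
      (∀ p ∈ E, dist (Θ p) p < ε) → μ (E ∩ (D \ Θ ⁻¹' D)) ≤ η := by
  have hη2 : η / 2 ≠ 0 := by simpa using hη
  obtain ⟨K, hKD, hK, hDK⟩ := hD.exists_isCompact_sdiff_lt hμD hη2
  obtain ⟨U, hDU, hU, -, hUD⟩ := hD.exists_isOpen_sdiff_lt hμD hη2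
  obtain ⟨ε, hε, hεU⟩ := hK.exists_thickening_subset_open hU (hKD.trans hDU)
  refine ⟨ε, hε, fun Θ E hΘ hE => ?_⟩
  have hsub : E ∩ (D \ Θ ⁻¹' D) ⊆ (D \ K) ∪ Θ ⁻¹' (U \ D) := by
    rintro p ⟨hpE, hpD, hpΘ⟩
    by_cases hpK : p ∈ K
    · exact Or.inr ⟨hεU (Metric.mem_thickening_iff.2 ⟨p, hpK, hE p hpE⟩), hpΘ⟩
    · exact Or.inl ⟨hpD, hpK⟩
  calc μ (E ∩ (D \ Θ ⁻¹' D)) ≤ μ (D \ K) + μ (Θ ⁻¹' (U \ D)) :=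
        (measure_mono hsub).trans (measure_union_le _ _)
    _ = μ (D \ K) + μ (U \ D) := by
        rw [hΘ.measure_preimage (hU.measurableSet.diff hD).nullMeasurableSet]
    _ ≤ η / 2 + η / 2 := add_le_add hDK.le hUD.le
    _ = η := ENNReal.add_halves η

/-- For `g ∈ G` close to `a`, leaving `E` under translation by `a` forces leaving `E` already under
the tiny translation by `a - g`, and inside a ball this has small measure. -/
theorem ae_mem_imp_add_mem_of_dense {E G : Set ℝ} (hE : MeasurableSet E) (hG : Dense G)
    (h : ∀ g ∈ G, ∀ᵐ t : ℝ, t ∈ E → t + g ∈ E) (a : ℝ) : ∀ᵐ t : ℝ, t ∈ E → t + a ∈ E := by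
  have key : ∀ M : ℕ, volume ((E \ (· + a) ⁻¹' E) ∩ Metric.ball 0 M) = 0 := by
    intro M
    refine nonpos_iff_eq_zero.1 (le_of_forall_pos_le_add fun η hη => ?_)
    rw [zero_add]
    obtain ⟨ε, hε, hΘ⟩ := exists_pos_forall_measure_inter_diff_preimage_le (μ := volume)
      (hE.inter (measurableSet_ball (x := (0 : ℝ)) (ε := M + 1)))
      (measure_ne_top_of_subset inter_subset_right measure_ball_lt_top.ne) hη.ne'
    obtain ⟨g, hg, hga⟩ := Metric.mem_closure_iff.1 (hG a) (min ε 1) (by positivity)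
    have hag : |a - g| < ε ∧ |a - g| < 1 := by simpa [Real.dist_eq] using hga
    refine le_trans ?_ (hΘ (· + (a - g)) (Metric.ball 0 M) (measurePreserving_add_right _ _)
      fun p _ => by simpa [Real.dist_eq] using hag.1)
    refine measure_mono_ae ?_
    have h' : ∀ᵐ t : ℝ, t + (a - g) ∈ E → t + (a - g) + g ∈ E :=
      (measurePreserving_add_right volume (a - g)).quasiMeasurePreserving.ae (h g hg)
    filter_upwards [h'] with t ht
    rintro ⟨⟨htE, hta⟩, htM⟩
    have htM' : |t| < M := by simpa [Real.dist_eq] using htM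
    refine ⟨htM, ⟨htE, ?_⟩, fun hc => hta ?_⟩
    · simp only [Metric.mem_ball, Real.dist_eq, sub_zero]; linarith
    · have := ht hc.1
      rwa [show t + (a - g) + g = t + a by ring] at this
  have : volume (⋃ M : ℕ, (E \ (· + a) ⁻¹' E) ∩ Metric.ball 0 M) = 0 :=
    measure_iUnion_null key
  rw [← inter_iUnion, Metric.iUnion_ball_nat, inter_univ] at this
  filter_upwards [measure_eq_zero_iff_ae_notMem.1 this] with t ht htE
  by_contra hc
  exact ht ⟨htE, hc⟩

/-- A set of reals that is a.e. invariant under a dense set of translations is null or conull. -/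
theorem eventuallyConst_of_dense_translations {E G : Set ℝ} (hE : MeasurableSet E) (hG : Dense G)
    (h : ∀ g ∈ G, ∀ᵐ t : ℝ, t ∈ E ↔ t + g ∈ E) : EventuallyConst E (ae (volume : Measure ℝ)) := by
  refine aeconst_of_forall_preimage_vadd_ae_eq ℝ hE.nullMeasurableSet fun a => ?_
  have h₁ := ae_mem_imp_add_mem_of_dense hE hG (fun g hg => (h g hg).mono fun t ht => ht.1) a
  have h₂ := ae_mem_imp_add_mem_of_dense hE.compl hG
    (fun g hg => (h g hg).mono fun t ht => mt ht.2) a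
  refine eventuallyEq_set.2 ?_
  filter_upwards [h₁, h₂] with t h₁ h₂
  simp only [mem_preimage, vadd_eq_add, add_comm a t]
  exact ⟨fun h => by_contra fun hc => h₂ hc h, h₁⟩

/-! ### Real extensions and rigid essential values -/

section Skew

variable {X : Type*}

/-- The skew product over `R` with cocycle `F`. -/
def realExtension (R : X → X) (F : X → ℝ) (p : X × ℝ) : X × ℝ := (R p.1, p.2 + F p.1)

theorem realExtension_iterate (R : X → X) (F : X → ℝ) (n : ℕ) (p : X × ℝ) :
    (realExtension R F)^[n] p = (R^[n] p.1, p.2 + birkhoffSum R F n p.1) := by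
  induction n with
  | zero => simp
  | succ n ih =>
    rw [Function.iterate_succ_apply', ih, Function.iterate_succ_apply', birkhoffSum_succ]
    simp [realExtension, add_assoc]

/-- The two fibres are translates of each other. Hence fibre measure is an `R`-invariant function,
to which ergodicity of the base applies. -/
theorem volume_fiber_map {R : X → X} {F : X → ℝ} {D : Set (X × ℝ)}
    (hD : realExtension R F ⁻¹' D = D) (x : X) :
    volume (Prod.mk (R x) ⁻¹' D) = volume (Prod.mk x ⁻¹' D) := by
  have : Prod.mk x ⁻¹' D = (· + F x) ⁻¹' (Prod.mk (R x) ⁻¹' D) := by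
    conv_lhs => rw [← hD]
    rfl
  rw [this, measure_preimage_add_right]

variable [MeasurableSpace X]

theorem measurePreserving_realExtension {μ : Measure X} [SFinite μ] {R : X → X} {F : X → ℝ}
    (hR : MeasurePreserving R μ μ) (hF : Measurable F) :
    MeasurePreserving (realExtension R F) (μ.prod volume) (μ.prod volume) :=
  hR.skew_product (g := fun x t => t + F x) (by fun_prop)
    (Eventually.of_forall fun x => (measurePreserving_add_right volume (F x)).map_eq)

/-- A rigid form of essential values: arbitrarily small returns of `R` along which the Birkhoff sum
is close to `a` on a set of measure bounded below. -/
def IsRigidEssentialValue [PseudoMetricSpace X] (μ : Measure X) (R : X → X) (F : X → ℝ) (a : ℝ) :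
    Prop :=
  ∃ δ : ENNReal, δ ≠ 0 ∧ ∀ ε : ℝ, 0 < ε → ∃ n : ℕ, ∃ B : Set X, MeasurableSet B ∧ δ ≤ μ B ∧
    ∀ x ∈ B, dist (R^[n] x) x < ε ∧ |birkhoffSum R F n x - a| < ε

variable [MetricSpace X] [CompactSpace X] [BorelSpace X] {μ : Measure X} [IsFiniteMeasure μ]
  {R : X → X} {F : X → ℝ} {D : Set (X × ℝ)}

/-- The set `H` of points that leave `D` under the shift by `-a` is itself invariant. If it is not
null, almost every fibre of `H` has positive measure, so a fixed amount of `H` at bounded height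
lies over every `B` of measure at least `δ`. But the `n`-th iterate followed by the shift is nearly
the identity over `B`, so it can move only little of `D` out of `D`; by invariance it moves all of
that part of `H` out. -/
theorem measure_diff_translation_eq_zero (hR : Ergodic R μ) (hF : Measurable F)
    (hDm : MeasurableSet D) (hD : realExtension R F ⁻¹' D = D) {a : ℝ}
    (ha : IsRigidEssentialValue μ R F a) :
    (μ.prod volume) (D \ (fun p : X × ℝ => (p.1, p.2 - a)) ⁻¹' D) = 0 := by
  set V : X × ℝ → X × ℝ := fun p => (p.1, p.2 - a) with hV
  have hVmp : MeasurePreserving V (μ.prod volume) (μ.prod volume) := by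
    simpa [realExtension, sub_eq_add_neg] using! measurePreserving_realExtension
      (MeasurePreserving.id μ) (measurable_const (a := -a))
  have hVD : realExtension R F ⁻¹' (V ⁻¹' D) = V ⁻¹' D := by
    conv_rhs => rw [← hD]
    ext p
    simp only [hV, realExtension, mem_preimage]
    rw [add_sub_right_comm]
  set H : Set (X × ℝ) := D \ V ⁻¹' D with hH
  have hHm : MeasurableSet H := hDm.diff (hVmp.measurable hDm)
  have hHinv : realExtension R F ⁻¹' H = H := by rw [hH, preimage_sdiff, hD, hVD]
  have hm : Measurable fun x => volume (Prod.mk x ⁻¹' H) := measurable_measure_prodMk_left hHm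
  obtain h | h := hR.toPreErgodic.ae_mem_or_ae_notMem (s := {x | volume (Prod.mk x ⁻¹' H) = 0})
    (hm (measurableSet_singleton 0)) (by ext x; simp [volume_fiber_map hHinv])
  · exact (Measure.measure_prod_null hHm).2 h
  exfalso
  obtain ⟨δ, hδ, hδB⟩ := ha
  let Hk : ℕ → Set (X × ℝ) := fun k => H ∩ {p | |p.2| ≤ k}
  have hkm : ∀ k : ℕ, MeasurableSet {p : X × ℝ | |p.2| ≤ k} := fun k =>
    measurableSet_le (by fun_prop) measurable_const
  have hHk : ∀ k, MeasurableSet (Hk k) := fun k => hHm.inter (hkm k)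
  let A : ℕ → Set X := fun k => {x | ((k : ENNReal) + 1)⁻¹ < volume (Prod.mk x ⁻¹' Hk k)}
  have hA : ∀ k, MeasurableSet (A k) := fun k =>
    measurableSet_lt measurable_const (measurable_measure_prodMk_left (hHk k))
  have hHmono : Monotone Hk := fun i j hij p hp =>
    ⟨hp.1, le_trans (show |p.2| ≤ i from hp.2) (by exact_mod_cast hij)⟩
  have hAmono : Monotone A := fun i j hij x hx => by
    refine lt_of_le_of_lt ?_ (lt_of_lt_of_le (show _ < _ from hx)
      (measure_mono (preimage_mono (hHmono hij))))
    gcongr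
  have hAnull : μ (⋂ k, (A k)ᶜ) = 0 := by
    refine measure_mono_null (fun x hx => ?_) h
    change ¬ ¬ (volume (Prod.mk x ⁻¹' H) = 0)
    rw [not_not]
    by_contra hx0
    have hlim : Tendsto (fun k => volume (Prod.mk x ⁻¹' Hk k)) atTop
        (𝓝 (volume (Prod.mk x ⁻¹' H))) := by
      have hU : Prod.mk x ⁻¹' H = ⋃ k, Prod.mk x ⁻¹' Hk k := by
        ext t
        simp only [mem_preimage, mem_iUnion, Hk, mem_inter_iff, exists_and_left]
        exact ⟨fun ht => ⟨ht, exists_nat_ge |t|⟩, fun ht => ht.1⟩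
      rw [hU]
      exact tendsto_measure_iUnion_atTop (fun i j hij => preimage_mono (hHmono hij))
    have hinv : Tendsto (fun k : ℕ => ((k : ENNReal) + 1)⁻¹) atTop (𝓝 0) := by
      have := (tendsto_add_atTop_iff_nat (f := fun n : ℕ => (n : ENNReal)⁻¹) 1).2
        ENNReal.tendsto_inv_nat_nhds_zero
      simpa using this
    obtain ⟨k, hk⟩ := (hinv.eventually_lt hlim (pos_iff_ne_zero.2 hx0)).exists
    exact mem_iInter.1 hx k hk
  -- The sets `A k` increase to almost all of the base, so one of them meets every `B` of measure at
  -- least `δ` in measure at least `δ / 2`.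
  obtain ⟨k, hk⟩ : ∃ k, μ (A k)ᶜ < δ / 2 := by
    have := tendsto_measure_iInter_atTop (μ := μ) (s := fun k => (A k)ᶜ)
      (fun k => (hA k).compl.nullMeasurableSet) (fun i j hij => compl_subset_compl.2 (hAmono hij))
      ⟨0, measure_ne_top _ _⟩
    rw [hAnull] at this
    exact (this.eventually_lt_const (by simpa [pos_iff_ne_zero] using hδ)).exists
  have hδtop : δ ≠ ⊤ := by
    obtain ⟨n, B, -, hB, -⟩ := hδB 1 one_pos
    exact ne_top_of_le_ne_top (measure_ne_top μ B) hB
  set c : ENNReal := ((k : ENNReal) + 1)⁻¹ * (δ / 2) with hc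
  have hc0 : c ≠ 0 := mul_ne_zero (by simp [ENNReal.add_eq_top]) (by simpa using hδ)
  have hctop : c ≠ ⊤ := ENNReal.mul_ne_top (by simp) (ENNReal.div_ne_top hδtop two_ne_zero)
  have hD0 : (μ.prod volume) (D ∩ {p : X × ℝ | |p.2| ≤ (k + 1 : ℕ)}) ≠ ⊤ := by
    refine measure_ne_top_of_subset (s := univ ×ˢ Metric.closedBall (0 : ℝ) (k + 1 : ℕ))
      ?_ ?_
    · exact fun p hp => ⟨mem_univ _, by simpa [Real.dist_eq] using! hp.2⟩
    rw [Measure.prod_prod]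
    exact ENNReal.mul_ne_top (measure_ne_top _ _) measure_closedBall_lt_top.ne
  obtain ⟨ε, hε, hΘ⟩ := exists_pos_forall_measure_inter_diff_preimage_le (μ := μ.prod volume)
    (hDm.inter (hkm (k + 1))) hD0 (η := c / 2) (by simpa using hc0)
  obtain ⟨n, B, hBm, hδB, hB⟩ := hδB (min ε 1) (by positivity)
  have hΘmp := hVmp.comp ((measurePreserving_realExtension hR.toMeasurePreserving hF).iterate n)
  have hΘp : ∀ p : X × ℝ, (V ∘ (realExtension R F)^[n]) p =
      (R^[n] p.1, p.2 + (birkhoffSum R F n p.1 - a)) := fun p => by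
    simp [hV, realExtension_iterate, add_sub_assoc]
  have hle := hΘ _ (B ×ˢ {t : ℝ | |t| ≤ k}) hΘmp (by
    rintro p ⟨hp, -⟩
    rw [hΘp, Prod.dist_eq]
    refine max_lt ((hB _ hp).1.trans_le (min_le_left _ _)) ?_
    simpa [Real.dist_eq] using (hB _ hp).2.trans_le (min_le_left _ _))
  have hsub : Hk k ∩ Prod.fst ⁻¹' (B ∩ A k) ⊆ (B ×ˢ {t : ℝ | |t| ≤ k}) ∩
      ((D ∩ {p : X × ℝ | |p.2| ≤ (k + 1 : ℕ)}) \ (V ∘ (realExtension R F)^[n]) ⁻¹'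
        (D ∩ {p : X × ℝ | |p.2| ≤ (k + 1 : ℕ)})) := by
    rintro p ⟨⟨⟨hpD, hpV⟩, hpk⟩, hpB, -⟩
    have hpk' : |p.2| ≤ k := hpk
    refine ⟨⟨hpB, hpk⟩, ⟨hpD, ?_⟩, fun hc => hpV ?_⟩
    · simp only [Nat.cast_add, Nat.cast_one, mem_ofPred_eq]; linarith
    -- `V ⁻¹' D` is invariant, so the image under the composite lies in `D` exactly when `V p` does.
    · have hfix := Function.iterate_fixed hVD n
      rw [← preimage_iterate_eq] at hfix
      rw [← hfix]
      exact hc.1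
  have hlow : c ≤ (μ.prod volume) (Hk k ∩ Prod.fst ⁻¹' (B ∩ A k)) := by
    have hBA : δ / 2 ≤ μ (B ∩ A k) := by
      have h1 : μ B ≤ μ (B ∩ A k) + μ (A k)ᶜ := by
        refine (measure_mono fun x hx => ?_).trans (measure_union_le _ _)
        by_cases hxA : x ∈ A k
        exacts [Or.inl ⟨hx, hxA⟩, Or.inr hxA]
      have h2 : δ / 2 + δ / 2 ≤ μ (B ∩ A k) + δ / 2 := by
        rw [ENNReal.add_halves]
        exact hδB.trans (h1.trans (add_le_add le_rfl hk.le))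
      exact (ENNReal.add_le_add_iff_right (ENNReal.div_ne_top hδtop two_ne_zero)).1 h2
    rw [Measure.prod_apply ((hHk k).inter (measurable_fst (hBm.inter (hA k))))]
    calc c ≤ ((k : ENNReal) + 1)⁻¹ * μ (B ∩ A k) := mul_le_mul' le_rfl hBA
      _ = ∫⁻ _ in B ∩ A k, ((k : ENNReal) + 1)⁻¹ ∂μ := by rw [setLIntegral_const]
      _ ≤ ∫⁻ x in B ∩ A k, volume (Prod.mk x ⁻¹' (Hk k ∩ Prod.fst ⁻¹' (B ∩ A k))) ∂μ := by
        refine setLIntegral_mono' (hBm.inter (hA k)) fun x hx => ?_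
        refine le_trans (show _ < _ from hx.2).le (measure_mono fun t ht => ⟨ht, hx⟩)
      _ ≤ _ := setLIntegral_le_lintegral _ _
  have : c ≤ c / 2 := hlow.trans ((measure_mono hsub).trans hle)
  exact absurd this (not_le.2 (ENNReal.half_lt_self hc0 hctop))

theorem ae_mem_iff_translation_mem (hR : Ergodic R μ) (hF : Measurable F)
    (hDm : MeasurableSet D) (hD : realExtension R F ⁻¹' D = D) {a : ℝ}
    (ha : IsRigidEssentialValue μ R F a) :
    ∀ᵐ p ∂(μ.prod volume), p ∈ D ↔ (p.1, p.2 - a) ∈ D := by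
  have h₁ := measure_diff_translation_eq_zero hR hF hDm hD ha
  have h₂ := measure_diff_translation_eq_zero hR hF hDm.compl (by rw [preimage_compl, hD]) ha
  filter_upwards [measure_eq_zero_iff_ae_notMem.1 h₁, measure_eq_zero_iff_ae_notMem.1 h₂]
    with p h₁ h₂
  simp only [Set.mem_sdiff, mem_preimage, mem_compl_iff] at h₁ h₂
  tauto

/-- The vertical translations that preserve `D` up to a null set. -/
def verticalPeriods (μ : Measure X) [SFinite μ] (D : Set (X × ℝ)) : AddSubgroup ℝ where
  carrier := {a | ∀ᵐ p ∂(μ.prod volume), p ∈ D ↔ (p.1, p.2 + a) ∈ D}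
  zero_mem' := by simp
  add_mem' := by
    intro a b ha hb
    have h := (measurePreserving_realExtension (MeasurePreserving.id μ)
      (measurable_const (a := a))).quasiMeasurePreserving.ae hb
    simp only [mem_ofPred_eq]
    filter_upwards [ha, h] with p h₁ h₂
    rw [h₁]
    simpa [realExtension, add_assoc] using! h₂
  neg_mem' := by
    intro a ha
    have h := (measurePreserving_realExtension (MeasurePreserving.id μ)
      (measurable_const (a := -a))).quasiMeasurePreserving.ae ha
    simp only [mem_ofPred_eq]
    filter_upwards [h] with p h
    simpa [realExtension] using! h.symm

theorem mem_verticalPeriods {a : ℝ} : a ∈ verticalPeriods μ D ↔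
    ∀ᵐ p ∂(μ.prod volume), p ∈ D ↔ (p.1, p.2 + a) ∈ D := Iff.rfl

/-- A countable dense set of periods has a common exceptional null set, so almost every fibre is
null or conull. Fibre measure is invariant under the ergodic base, so the same alternative holds
over almost every point. -/
theorem eventuallyConst_of_dense_verticalPeriods (hR : Ergodic R μ)
    (hDm : MeasurableSet D) (hD : realExtension R F ⁻¹' D = D)
    (hG : Dense (verticalPeriods μ D : Set ℝ)) : EventuallyConst D (ae (μ.prod volume)) := by
  obtain ⟨s, hs, hsc, hsd⟩ := hG.exists_countable_dense_subset
  have hfib : ∀ᵐ x ∂μ, EventuallyConst (Prod.mk x ⁻¹' D) (ae (volume : Measure ℝ)) := by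
    have := (ae_ball_iff hsc).2 fun a ha => Measure.ae_ae_of_ae_prod (mem_verticalPeriods.1 (hs ha))
    filter_upwards [this] with x hx
    exact eventuallyConst_of_dense_translations (measurable_prodMk_left hDm) hsd hx
  have hm : Measurable fun x => volume (Prod.mk x ⁻¹' D) := measurable_measure_prodMk_left hDm
  rw [eventuallyConst_set]
  obtain h | h := hR.toPreErgodic.ae_mem_or_ae_notMem (s := {x | volume (Prod.mk x ⁻¹' D) = 0})
    (hm (measurableSet_singleton 0)) (by ext x; simp [volume_fiber_map hD])
  · exact Or.inr (measure_eq_zero_iff_ae_notMem.1 ((Measure.measure_prod_null hDm).2 h))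
  · refine Or.inl ?_
    have : (μ.prod volume) Dᶜ = 0 := by
      rw [Measure.measure_prod_null hDm.compl]
      filter_upwards [h, hfib] with x hx hc
      rcases eventuallyConst_set.1 hc with hc | hc
      · exact measure_eq_zero_iff_ae_notMem.2 (hc.mono fun t ht hn => hn ht)
      · exact absurd (measure_eq_zero_iff_ae_notMem.2 hc) hx
    exact (measure_eq_zero_iff_ae_notMem.1 this).mono fun p hp => not_not.1 hp

/-- A real extension of an ergodic map with uncountably many rigid essential values is ergodic. -/
theorem ergodic_realExtension (hR : Ergodic R μ) (hF : Measurable F)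
    (h : ¬ {a | IsRigidEssentialValue μ R F a}.Countable) :
    Ergodic (realExtension R F) (μ.prod volume) := by
  refine ⟨measurePreserving_realExtension hR.toMeasurePreserving hF, ⟨fun D hDm hD => ?_⟩⟩
  refine eventuallyConst_of_dense_verticalPeriods hR hDm hD ?_
  -- A cyclic group of periods would be countable, yet it contains every rigid essential value.
  refine (AddSubgroup.dense_or_cyclic _).resolve_right ?_
  rintro ⟨g, hg⟩
  refine h (Countable.mono (fun a ha => ?_)
    (show (verticalPeriods μ D : Set ℝ).Countable from ?_))
  · rw [SetLike.mem_coe, ← neg_mem_iff]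
    refine mem_verticalPeriods.2 ?_
    simpa only [sub_eq_add_neg] using ae_mem_iff_translation_mem hR hF hDm hD ha
  · rw [hg, ← AddSubgroup.zmultiples_eq_closure]
    exact countable_range _

end Skew

/-! ### Metric Diophantine approximation -/

/-- Dirichlet's theorem gives infinitely many fractions. Only finitely many share a denominator, so
infinitely many denominators occur. -/
theorem Irrational.infinite_setOf_coprime_abs_sub_lt {θ : ℝ} (hθ : Irrational θ) :
    {q : ℕ | ∃ p : ℤ, IsCoprime p (q : ℤ) ∧ |θ - p / q| < 1 / (q : ℝ) ^ 2}.Infinite := by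
  intro hfin
  refine Real.infinite_rat_abs_sub_lt_one_div_den_sq_of_irrational hθ ?_
  refine Set.Finite.of_finite_fibers (f := Rat.den) (hfin.subset ?_) ?_
  · rintro _ ⟨r, hr, rfl⟩
    refine ⟨r.num, Int.isCoprime_iff_gcd_eq_one.2 r.reduced, ?_⟩
    have : ((r.num : ℝ) / (r.den : ℝ)) = r := by exact_mod_cast r.num_div_den
    rw [this]
    exact hr
  · rintro d -
    refine ((Set.finite_Icc ⌊d * (θ - 1)⌋ ⌈d * (θ + 1)⌉).image
      (fun n : ℤ => (n : ℚ) / d)).subset ?_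
    rintro r ⟨hr, rfl⟩
    have hr : |θ - r| < 1 / (r.den : ℝ) ^ 2 := hr
    have hd : (1 : ℝ) ≤ r.den := by exact_mod_cast r.pos
    have hd1 : 1 / (r.den : ℝ) ^ 2 ≤ 1 := by
      rw [div_le_one (by positivity)]
      nlinarith
    have hrd : (r.den : ℝ) * r = r.num := by exact_mod_cast r.den_mul_eq_num
    obtain ⟨h1, h2⟩ := abs_lt.1 (hr.trans_le hd1)
    refine ⟨r.num, ⟨?_, ?_⟩, r.num_div_den⟩
    · have : (⌊r.den * (θ - 1)⌋ : ℝ) ≤ r.num := by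
        rw [← hrd]
        exact (Int.floor_le _).trans (by gcongr; linarith)
      exact_mod_cast this
    · have : (r.num : ℝ) ≤ (⌈r.den * (θ + 1)⌉ : ℝ) := by
        rw [← hrd]
        exact le_trans (by gcongr; linarith) (Int.le_ceil _)
      exact_mod_cast this

/-- Scaling the radii does not change the set of points that are approximated infinitely often. -/
theorem ae_infinite_setOf_dist_lt_mul {p : ℕ → Prop} {s : ℕ → Set ℝ} {r : ℕ → ℝ}
    (hr : Tendsto r atTop (𝓝 0)) (h : ∀ᵐ x : ℝ, {i | p i ∧ ∃ y ∈ s i, |x - y| < r i}.Infinite)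
    {ε : ℝ} (hε : 0 < ε) : ∀ᵐ x : ℝ, {i | p i ∧ ∃ y ∈ s i, |x - y| < ε * r i}.Infinite := by
  -- Cassels' lemma: multiplying the radii by a constant changes the limsup set only by a null set.
  have := eventuallyEq_set.1 (blimsup_thickening_mul_ae_eq (volume : Measure ℝ) p s hε r hr)
  filter_upwards [h, this] with x hx hiff
  simp only [← Nat.cofinite_eq_atTop, cofinite.blimsup_set_eq, Metric.mem_thickening_iff,
    mem_ofPred_eq, Real.dist_eq] at hiff
  exact hiff.2 hx

theorem ae_infinite_setOf_coprime_abs_sub_lt {ε : ℝ} (hε : 0 < ε) :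
    ∀ᵐ θ : ℝ, {q : ℕ | ∃ p : ℤ, IsCoprime p (q : ℤ) ∧
      |θ - p / q| < ε * (1 / (q : ℝ) ^ 2)}.Infinite := by
  have hr : Tendsto (fun q : ℕ => 1 / (q : ℝ) ^ 2) atTop (𝓝 0) := by
    simpa [Function.comp_def] using (tendsto_pow_atTop (α := ℝ) two_ne_zero).inv_tendsto_atTop.comp
      tendsto_natCast_atTop_atTop
  have h : ∀ᵐ x : ℝ, {q : ℕ | True ∧ ∃ y ∈ {y : ℝ | ∃ p : ℤ, IsCoprime p (q : ℤ) ∧ y = p / q},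
      |x - y| < 1 / (q : ℝ) ^ 2}.Infinite := by
    filter_upwards [(countable_range ((↑) : ℚ → ℝ)).ae_notMem volume] with x hx
    refine (Irrational.infinite_setOf_coprime_abs_sub_lt hx).mono ?_
    rintro q ⟨p, hp, hpq⟩
    exact ⟨trivial, _, ⟨p, hp, rfl⟩, hpq⟩
  filter_upwards [ae_infinite_setOf_dist_lt_mul hr h hε] with θ hθ
  refine hθ.mono ?_
  rintro q ⟨-, _, ⟨p, hp, rfl⟩, hpq⟩
  exact ⟨p, hp, hpq⟩

/-- Along an infinite set of multipliers, almost every real is inhomogeneously approximable. -/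
theorem ae_infinite_setOf_abs_mul_sub_sub_lt {Q : Set ℕ} (hQ : Q.Infinite) (c : ℝ) {ε : ℝ}
    (hε : 0 < ε) : ∀ᵐ β : ℝ, {q : ℕ | q ∈ Q ∧ ∃ N : ℤ, |q * β - N - c| < ε}.Infinite := by
  have key : ∀ {q : ℕ}, q ≠ 0 → ∀ (β δ : ℝ) (N : ℤ),
      |β - (N + c) / q| < δ * (1 / (q : ℝ)) ↔ |q * β - N - c| < δ := by
    intro q hq β δ N
    have hq' : (0 : ℝ) < q := by positivity
    rw [mul_one_div, lt_div_iff₀ hq', ← abs_of_pos hq', ← abs_mul, abs_of_pos hq', sub_mul,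
      div_mul_cancel₀ _ hq'.ne', mul_comm β, sub_sub]
  have h : ∀ᵐ x : ℝ, {q : ℕ | (q ∈ Q \ {0}) ∧ ∃ y ∈ {y : ℝ | ∃ N : ℤ, y = (N + c) / q},
      |x - y| < 1 / (q : ℝ)}.Infinite := by
    -- At radius `1 / q` every point qualifies by rounding; the scaling lemma then shrinks the
    -- radius to `ε / q`.
    refine Eventually.of_forall fun x => (hQ.sdiff (finite_singleton 0)).mono fun q hq => ?_
    refine ⟨hq, _, ⟨round (q * x - c), rfl⟩, ?_⟩
    rw [← one_mul (1 / (q : ℝ)), key hq.2, sub_right_comm]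
    exact (abs_sub_round _).trans_lt (by norm_num)
  filter_upwards [ae_infinite_setOf_dist_lt_mul (tendsto_const_div_atTop_nhds_zero_nat 1) h hε]
    with β hβ
  refine hβ.mono ?_
  rintro q ⟨hq, _, ⟨N, rfl⟩, hN⟩
  exact ⟨hq.1, N, (key hq.2 _ _ _).1 hN⟩

/-- Rational approximations of `θ` of quality `ε / q ^ 2` with `q * β` close to `c` modulo one. -/
def HasApproximation (θ β c ε : ℝ) (K : ℕ) : Prop :=
  ∃ q : ℕ, K ≤ q ∧ ∃ p N : ℤ, IsCoprime p (q : ℤ) ∧ |θ - p / q| < ε * (1 / (q : ℝ) ^ 2) ∧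
    |q * β - N - c| < ε

theorem HasApproximation.mono {θ β c c' ε ε' : ℝ} {K K' : ℕ}
    (h : HasApproximation θ β c ε K) (hε : ε + |c - c'| ≤ ε') (hK : K' ≤ K) :
    HasApproximation θ β c' ε' K' := by
  obtain ⟨q, hq, p, N, hp, hpq, hN⟩ := h
  refine ⟨q, hK.trans hq, p, N, hp, hpq.trans_le ?_, ?_⟩
  · gcongr
    linarith [abs_nonneg (c - c')]
  · calc |q * β - N - c'| = |(q * β - N - c) + (c - c')| := by ring_nf
      _ ≤ _ := abs_add_le _ _
      _ < ε' := by linarith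

/-- By Fubini: a generic `θ` fixes an infinite set of good denominators, along which almost every
`β` is approximable. Openness supplies measurability. -/
theorem ae_hasApproximation_of_pos (c : ℝ) {ε : ℝ} (hε : 0 < ε) (K : ℕ) :
    ∀ᵐ x : ℝ × ℝ, HasApproximation x.1 x.2 c ε K := by
  have hopen : IsOpen {x : ℝ × ℝ | HasApproximation x.1 x.2 c ε K} := by
    simp only [HasApproximation, ofPred_exists, ofPred_and]
    refine isOpen_iUnion fun q => isOpen_const.inter (isOpen_iUnion fun p => isOpen_iUnion fun N =>
      isOpen_const.inter (IsOpen.inter ?_ ?_))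
    · exact isOpen_lt (by fun_prop) (by fun_prop)
    · exact isOpen_lt (by fun_prop) (by fun_prop)
  rw [Measure.volume_eq_prod, Measure.ae_prod_iff_ae_ae hopen.measurableSet]
  filter_upwards [ae_infinite_setOf_coprime_abs_sub_lt hε] with θ hθ
  filter_upwards [ae_infinite_setOf_abs_mul_sub_sub_lt hθ c hε] with β hβ
  obtain ⟨q, ⟨⟨p, hp, hpq⟩, N, hN⟩, hq⟩ := hβ.exists_gt K
  exact ⟨q, hq.le, p, N, hp, hpq, hN⟩

theorem ae_forall_hasApproximation : ∀ᵐ x : ℝ × ℝ, ∀ (c ε : ℝ) (K : ℕ), 0 < ε →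
    HasApproximation x.1 x.2 c ε K := by
  have : ∀ᵐ x : ℝ × ℝ, ∀ (c : ℚ) (k K : ℕ), HasApproximation x.1 x.2 c (1 / (k + 1)) K :=
    ae_all_iff.2 fun c => ae_all_iff.2 fun k => ae_all_iff.2 fun K =>
      ae_hasApproximation_of_pos c Nat.one_div_pos_of_nat K
  filter_upwards [this] with x hx c ε K hε
  obtain ⟨k, hk⟩ := exists_nat_one_div_lt (half_pos hε)
  obtain ⟨r, hr1, hr2⟩ := exists_rat_btwn (show c < c + ε / 2 by linarith)
  refine (hx r k K).mono ?_ le_rfl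
  rw [abs_of_nonneg (by linarith)]
  linarith

/-! ### Cosine sums along arithmetic progressions -/

theorem two_sin_mul_sum_cos (x h : ℝ) (m : ℕ) :
    2 * Real.sin (Real.pi * h) * ∑ i ∈ Finset.range m, Real.cos (2 * Real.pi * (x + i * h)) =
      Real.sin (2 * Real.pi * (x + m * h) - Real.pi * h) -
        Real.sin (2 * Real.pi * x - Real.pi * h) := by
  induction m with
  | zero => simp
  | succ m ih =>
    rw [Finset.sum_range_succ, mul_add, ih]
    have h1 : 2 * Real.pi * (x + (m + 1 : ℕ) * h) - Real.pi * h =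
        2 * Real.pi * (x + m * h) + Real.pi * h := by push_cast; ring
    rw [h1, Real.sin_add, Real.sin_sub]
    ring

theorem abs_sin_sub_le {x : ℝ} (hx : |x| ≤ 1) : |Real.sin x - x| ≤ x ^ 2 / 2 := by
  have h5 : |x| ^ 5 ≤ |x| ^ 2 := pow_le_pow_of_le_one (abs_nonneg x) hx (by norm_num)
  have h3 : |x ^ 3 / 6| ≤ |x| ^ 2 / 6 := by
    rw [abs_div, abs_pow, abs_of_pos (by norm_num : (0 : ℝ) < 6)]
    gcongr ?_ / 6
    exact pow_le_pow_of_le_one (abs_nonneg x) hx (by norm_num)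
  calc |Real.sin x - x| = |(Real.sin x - (x - x ^ 3 / 6)) - x ^ 3 / 6| := by ring_nf
    _ ≤ |x| ^ 5 / 100 + |x| ^ 2 / 6 := (abs_sub _ _).trans (add_le_add (Real.sin_bound hx) h3)
    _ ≤ |x| ^ 2 / 2 := by linarith [sq_nonneg |x|]
    _ = x ^ 2 / 2 := by rw [sq_abs]

/-- The cosine over an arithmetic progression of step `h` filling `[0, 1]` up to an excess `r`. -/
theorem abs_sum_cos_sub_le {x h r : ℝ} {m : ℕ} (hh : 0 < h) (hh1 : Real.pi * h ≤ 1)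
    (hx0 : 0 ≤ x) (hxh : x ≤ h) (hm : m * h = 1 + r) (hr : |r| ≤ h) :
    |∑ i ∈ Finset.range m, Real.cos (2 * Real.pi * (x + i * h)) - r / h| ≤ 15 * h := by
  set S := ∑ i ∈ Finset.range m, Real.cos (2 * Real.pi * (x + i * h)) with hS
  set φ := Real.pi * (2 * x - h + r) with hφ
  have hpi := Real.pi_pos
  have hpi4 := Real.pi_lt_d2
  obtain ⟨hr1, hr2⟩ := abs_le.1 hr
  -- The sum telescopes to a difference of sines at `φ + π r` and `φ - π r`, once the full period is
  -- dropped.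
  have hsum : Real.sin (Real.pi * h) * S = Real.sin (Real.pi * r) * Real.cos φ := by
    have h1 := two_sin_mul_sum_cos x h m
    rw [← hS, hm, show 2 * Real.pi * (x + (1 + r)) - Real.pi * h = φ + Real.pi * r + 2 * Real.pi by
      rw [hφ]; ring, show 2 * Real.pi * x - Real.pi * h = φ - Real.pi * r by rw [hφ]; ring,
      Real.sin_add_two_pi, Real.sin_add, Real.sin_sub] at h1
    linarith
  have hs : 2 * h ≤ Real.sin (Real.pi * h) := by
    have := Real.mul_le_sin (x := Real.pi * h) (by positivity) (by linarith [Real.pi_gt_three])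
    rwa [← mul_assoc, div_mul_cancel₀ _ hpi.ne'] at this
  have hs0 : 0 < Real.sin (Real.pi * h) := by linarith
  have hpr : |Real.pi * r| ≤ Real.pi * h := by
    rw [abs_mul, abs_of_pos hpi]; gcongr
  have e1 := abs_sin_sub_le (hpr.trans hh1)
  have e2 := abs_sin_sub_le (x := Real.pi * h) (by rwa [abs_of_pos (by positivity)])
  have hcos1 := Real.cos_le_one φ
  have hcos2 := Real.one_sub_sq_div_two_le_cos (x := φ)
  have hpi2 : Real.pi ^ 2 ≤ 10 := by nlinarith
  have hr2' : r ^ 2 ≤ h ^ 2 := sq_le_sq' hr1 hr2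
  have hφ2 : φ ^ 2 ≤ 40 * h ^ 2 := by
    have : (2 * x - h + r) ^ 2 ≤ (2 * h) ^ 2 := sq_le_sq' (by linarith) (by linarith)
    rw [hφ, mul_pow]
    nlinarith [sq_nonneg (2 * x - h + r)]
  have t1 : |h * (Real.sin (Real.pi * r) - Real.pi * r) * Real.cos φ| ≤ 5 * h ^ 3 := by
    rw [abs_mul, abs_mul, abs_of_pos hh]
    have : (Real.pi * r) ^ 2 / 2 ≤ 5 * h ^ 2 := by rw [mul_pow]; nlinarith [sq_nonneg r]
    calc h * |Real.sin (Real.pi * r) - Real.pi * r| * |Real.cos φ|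
        ≤ h * (5 * h ^ 2) * 1 := by gcongr; exacts [e1.trans this, Real.abs_cos_le_one φ]
      _ = 5 * h ^ 3 := by ring
  have t2 : |h * (Real.pi * r) * (Real.cos φ - 1)| ≤ 20 * h ^ 3 := by
    rw [abs_mul, abs_mul, abs_of_pos hh]
    have : |Real.cos φ - 1| ≤ 20 * h ^ 2 := by rw [abs_le]; constructor <;> nlinarith
    calc h * |Real.pi * r| * |Real.cos φ - 1| ≤ h * 1 * (20 * h ^ 2) := by
          gcongr; exact hpr.trans hh1
      _ = 20 * h ^ 3 := by ring
  have t3 : |r * (Real.sin (Real.pi * h) - Real.pi * h)| ≤ 5 * h ^ 3 := by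
    rw [abs_mul]
    have : (Real.pi * h) ^ 2 / 2 ≤ 5 * h ^ 2 := by rw [mul_pow]; nlinarith [sq_nonneg h]
    calc |r| * |Real.sin (Real.pi * h) - Real.pi * h| ≤ h * (5 * h ^ 2) := by
          gcongr; exact e2.trans this
      _ = 5 * h ^ 3 := by ring
  -- Linearising both sines and replacing `cos φ` by `1` costs `30 * h ^ 3` in all; dividing by `h *
  -- sin (π h) ≥ 2 * h ^ 2` leaves `15 * h`.
  have hnum : (S - r / h) * (h * Real.sin (Real.pi * h)) =
      h * (Real.sin (Real.pi * r) - Real.pi * r) * Real.cos φ +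
      h * (Real.pi * r) * (Real.cos φ - 1) - r * (Real.sin (Real.pi * h) - Real.pi * h) := by
    have : (S - r / h) * (h * Real.sin (Real.pi * h)) =
        h * (Real.sin (Real.pi * h) * S) - r * Real.sin (Real.pi * h) := by
      field_simp
    rw [this, hsum]
    ring
  have hden : 0 < h * Real.sin (Real.pi * h) := by positivity
  refine le_of_mul_le_mul_right ?_ hden
  rw [← abs_of_pos hden, ← abs_mul, abs_of_pos hden, hnum]
  calc _ ≤ 5 * h ^ 3 + 20 * h ^ 3 + 5 * h ^ 3 :=
        (abs_sub _ _).trans (add_le_add ((abs_add_le _ _).trans (add_le_add t1 t2)) t3)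
    _ = 15 * h * (h * (2 * h)) := by ring
    _ ≤ _ := by gcongr

theorem abs_cos_two_pi_mul_sub_le (x y : ℝ) :
    |Real.cos (2 * Real.pi * x) - Real.cos (2 * Real.pi * y)| ≤ 7 * |x - y| := by
  refine (Real.abs_cos_sub_cos_le _ _).trans ?_
  rw [← mul_sub, abs_mul, abs_of_pos Real.two_pi_pos]
  have := Real.pi_lt_d2
  gcongr
  linarith

/-- The truncated cosine. -/
noncomputable def cosCutoff (y : ℝ) : ℝ := if y < 1 then Real.cos (2 * Real.pi * y) else 0

theorem measurable_cosCutoff : Measurable cosCutoff :=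
  Measurable.ite measurableSet_Iio (by fun_prop) measurable_const

/-- The only jump is at `1`, and the displacement is too short to cross it. -/
theorem abs_cosCutoff_add_sub_le {y η : ℝ} (h : |η| < |y - 1|) :
    |cosCutoff (y + η) - cosCutoff y| ≤ 7 * |η| := by
  have hη := abs_lt.1 h
  unfold cosCutoff
  rcases lt_or_ge y 1 with hy | hy
  · rw [abs_of_neg (by linarith)] at hη
    rw [if_pos (by linarith), if_pos hy]
    simpa using abs_cos_two_pi_mul_sub_le (y + η) y
  · rw [abs_of_nonneg (by linarith)] at hη
    rw [if_neg (by linarith), if_neg (by linarith)]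
    simp

/-- Here `m` counts the progression points below `1`. They overshoot one full period by `m * h - 1`,
and only this excess contributes to the sum. -/
theorem exists_abs_sum_cosCutoff_sub_le {x h : ℝ} {q : ℕ} (hh : 0 < h) (hh1 : Real.pi * h ≤ 1)
    (hx0 : 0 ≤ x) (hxh : x < h) (hq : 1 ≤ q * h) :
    ∃ m : ℕ, |m - 1 / h| ≤ 1 ∧
      |∑ i ∈ Finset.range q, cosCutoff (x + i * h) - (m - 1 / h)| ≤ 15 * h := by
  have hh3 : h ≤ 1 := by nlinarith [Real.pi_gt_three]
  have hlt : ∀ i : ℕ, i < ⌈(1 - x) / h⌉₊ ↔ x + i * h < 1 := fun i => by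
    rw [Nat.lt_ceil, lt_div_iff₀ hh]
    constructor <;> intro <;> linarith
  have h1 : (1 - x) / h ≤ (⌈(1 - x) / h⌉₊ : ℝ) := Nat.le_ceil _
  have h2 : (⌈(1 - x) / h⌉₊ : ℝ) < (1 - x) / h + 1 :=
    Nat.ceil_lt_add_one (div_nonneg (by linarith) hh.le)
  have hmq : ⌈(1 - x) / h⌉₊ ≤ q := Nat.ceil_le.2 (by rw [div_le_iff₀ hh]; linarith)
  set m := ⌈(1 - x) / h⌉₊
  rw [div_le_iff₀ hh] at h1
  rw [← sub_lt_iff_lt_add, lt_div_iff₀ hh, sub_mul] at h2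
  have hr : |m * h - 1| ≤ h := by rw [abs_le]; constructor <;> linarith
  have hmr : (m : ℝ) - 1 / h = (m * h - 1) / h := by field_simp
  have hsum : ∑ i ∈ Finset.range q, cosCutoff (x + i * h) =
      ∑ i ∈ Finset.range m, Real.cos (2 * Real.pi * (x + i * h)) := by
    rw [← Finset.sum_subset (Finset.range_subset_range.2 hmq)]
    · refine Finset.sum_congr rfl fun i hi => if_pos ((hlt i).1 (Finset.mem_range.1 hi))
    · exact fun i _ hi => if_neg (mt (hlt i).2 (by simpa using hi))
  refine ⟨m, ?_, ?_⟩
  · rw [hmr, abs_div, abs_of_pos hh, div_le_one hh]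
    exact hr
  · rw [hmr, hsum]
    exact abs_sum_cos_sub_le hh hh1 hx0 hxh.le (by ring) hr

/-! ### The cocycle on the circle and its Birkhoff sums -/

section Circle

variable {L : ℝ} [hL : Fact (0 < L)]

/-- The representative in `[0, L)` of a point of the circle of length `L`. -/
noncomputable def circleRep (x : AddCircle L) : ℝ := AddCircle.equivIco L 0 x

theorem circleRep_mem (x : AddCircle L) : circleRep x ∈ Ico 0 L := by
  simpa [circleRep] using (AddCircle.equivIco L 0 x).2

theorem coe_circleRep (x : AddCircle L) : (circleRep x : AddCircle L) = x :=
  AddCircle.coe_equivIco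

theorem circleRep_coe {y : ℝ} (hy : y ∈ Ico 0 L) : circleRep (y : AddCircle L) = y :=
  AddCircle.equivIco_coe_of_mem (by simpa using hy)

theorem circleRep_coe_sub {y : ℝ} (hy : y - L ∈ Ico 0 L) :
    circleRep (y : AddCircle L) = y - L := by
  rw [← circleRep_coe hy, AddCircle.coe_sub, AddCircle.coe_period, sub_zero]

theorem measurable_circleRep : Measurable (circleRep : AddCircle L → ℝ) :=
  measurable_subtype_coe.comp (AddCircle.measurableEquivIco L 0).measurable

/-- The cocycle equal to `cos (2πy)` on `[0, 1)` and to `0` on `[1, L)`. -/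
noncomputable def circleCocycle (x : AddCircle L) : ℝ := cosCutoff (circleRep x)

theorem measurable_circleCocycle : Measurable (circleCocycle : AddCircle L → ℝ) :=
  measurable_cosCutoff.comp measurable_circleRep

/-- As `p` is invertible modulo `q`, `j ↦ k + j * p` permutes the residues. This reorders a rotation
orbit into a progression. -/
theorem sum_range_emod_eq {q : ℕ} (hq : 0 < q) {p : ℤ} (hp : IsCoprime p (q : ℤ)) (k : ℤ)
    (g : ℕ → ℝ) :
    ∑ j ∈ Finset.range q, g ((k + j * p) % q).toNat = ∑ i ∈ Finset.range q, g i := by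
  have hq0 : (0 : ℤ) < q := by exact_mod_cast hq
  have hmem : ∀ j : ℕ, ((k + j * p) % q).toNat < q := fun j => by
    have h1 := Int.emod_nonneg (k + j * p) hq0.ne'
    have h2 := Int.emod_lt_of_pos (k + j * p) hq0
    omega
  have hinj : Set.InjOn (fun j : ℕ => ((k + j * p) % q).toNat) (Finset.range q) := by
    intro i hi j hj hij
    have hi : i < q := by simpa using hi
    have hj : j < q := by simpa using hj
    have h1 := Int.emod_nonneg (k + i * p) hq0.ne'
    have h2 := Int.emod_nonneg (k + j * p) hq0.ne'
    have hij : ((k + i * p) % q).toNat = ((k + j * p) % q).toNat := hij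
    have h3 : (k + i * p) % q = (k + j * p) % q := by omega
    have h4 : (q : ℤ) ∣ (j - i : ℤ) * p := by
      have := Int.ModEq.dvd h3
      rwa [show (k + j * p) - (k + i * p) = (j - i : ℤ) * p by ring] at this
    have h5 := (hp.symm).dvd_of_dvd_mul_right h4
    have h6 := Int.eq_zero_of_abs_lt_dvd h5 (by rw [abs_lt]; constructor <;> omega)
    omega
  rw [← Finset.sum_image hinj]
  congr 1
  refine Finset.eq_of_subset_of_card_le (fun i hi => ?_) ?_
  · obtain ⟨j, -, rfl⟩ := Finset.mem_image.1 hi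
    exact Finset.mem_range.2 (hmem j)
  · rw [Finset.card_image_of_injOn hinj]

/-- Birkhoff sums of the cocycle along a denominator `q` of a good approximation `p / q` of the
rotation number, off the points whose orbit comes close to a discontinuity. -/
theorem exists_abs_birkhoffSum_circleCocycle_sub_le (hL1 : 1 ≤ L) {α ε : ℝ} {q : ℕ} {p : ℤ}
    (hq : 0 < q) (hp : IsCoprime p (q : ℤ)) (hα : |α / L - p / q| ≤ ε * (1 / (q : ℝ) ^ 2))
    (hqL : Real.pi * (L / q) ≤ 1) {x : AddCircle L}
    (h0 : ∀ i : ℤ, ε * (L / q) < |circleRep x - i * (L / q)|)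
    (h1 : ∀ i : ℤ, ε * (L / q) < |circleRep x - 1 - i * (L / q)|) :
    ∃ m : ℕ, |m - q / L| ≤ 1 ∧
      |birkhoffSum (· + (α : AddCircle L)) circleCocycle q x - (m - q / L)|
        ≤ 15 * (L / q) + 7 * (ε * L) := by
  have hL0 : 0 < L := hL.out
  have hq' : (0 : ℝ) < q := by exact_mod_cast hq
  set h := L / q with hh
  have hpos : 0 < h := by positivity
  have hqh : q * h = L := by rw [hh]; field_simp
  set y := circleRep x with hy
  set k : ℤ := ⌊y / h⌋ with hk
  have hk1 : k * h ≤ y := (le_div_iff₀ hpos).1 (Int.floor_le _)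
  have hk2 : y < (k + 1) * h := (div_lt_iff₀ hpos).1 (Int.lt_floor_add_one _)
  set x₀ := y - k * h with hx₀
  have hx0 : ε * h < x₀ := by
    have := h0 k
    rwa [abs_of_nonneg (by linarith)] at this
  have hxh : x₀ < h - ε * h := by
    have := h0 (k + 1)
    push_cast at this
    rw [abs_of_neg (by linarith)] at this
    rw [hx₀]
    linarith
  have hx00 : 0 ≤ x₀ := by rw [hx₀]; linarith
  have hx0h : x₀ < h := by rw [hx₀]; linarith
  obtain ⟨m, hm1, hm2⟩ := exists_abs_sum_cosCutoff_sub_le (q := q) hpos hqL hx00 hx0h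
    (by rw [hqh]; exact hL1)
  have hinv : 1 / h = q / L := by rw [hh, one_div_div]
  rw [hinv] at hm1 hm2
  refine ⟨m, hm1, ?_⟩
  have hterm : ∀ j ∈ Finset.range q, |circleCocycle ((· + (α : AddCircle L))^[j] x) -
      cosCutoff (x₀ + (((k + j * p) % q).toNat : ℕ) * h)| ≤ 7 * (ε * h) := by
    intro j hj
    have hjq : (j : ℝ) ≤ q := by exact_mod_cast (Finset.mem_range.1 hj).le
    have hq0 : (0 : ℤ) < q := by exact_mod_cast hq
    have hi1 := Int.emod_nonneg (k + j * p) hq0.ne'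
    have hi2 := Int.emod_lt_of_pos (k + j * p) hq0
    obtain ⟨i, hi⟩ := Int.eq_ofNat_of_zero_le hi1
    rw [hi, Int.toNat_natCast]
    have hiq : (i : ℝ) + 1 ≤ q := by
      have : (i : ℤ) + 1 ≤ q := by omega
      exact_mod_cast this
    set n : ℤ := (k + j * p) / q with hn
    have hdiv : (k : ℝ) + j * p = n * q + i := by
      have := Int.mul_ediv_add_emod (k + j * p) q
      rw [hi, ← hn] at this
      have : ((q * n + i : ℤ) : ℝ) = ((k + j * p : ℤ) : ℝ) := by rw [this]
      push_cast at this
      linarith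
    -- The drift of the `j`-th orbit point from the lattice model; it stays below `ε * h` because `j
    -- ≤ q`.
    set η := j * (α - p * h) with hη
    have hηle : |η| ≤ ε * h := by
      have e1 : α - p * h = L * (α / L - p / q) := by rw [hh]; field_simp
      have hε0 : 0 ≤ ε * (1 / (q : ℝ) ^ 2) := (abs_nonneg _).trans hα
      rw [hη, e1, abs_mul, abs_mul, abs_of_pos hL0, Nat.abs_cast]
      calc (j : ℝ) * (L * |α / L - p / q|) ≤ q * (L * (ε * (1 / (q : ℝ) ^ 2))) := by gcongr
        _ = ε * h := by rw [hh]; field_simp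
    have hyeq : y + j * α = x₀ + i * h + η + n * L := by
      rw [hη, hx₀]
      linear_combination h * hdiv + n * hqh
    have hpt : (· + (α : AddCircle L))^[j] x = ((x₀ + i * h + η : ℝ) : AddCircle L) := by
      rw [add_right_iterate]
      conv_lhs => rw [← coe_circleRep x, ← hy]
      beta_reduce
      rw [← AddCircle.coe_nsmul, ← AddCircle.coe_add, nsmul_eq_mul, hyeq, AddCircle.coe_add,
        ← zsmul_eq_mul, AddCircle.coe_zsmul, AddCircle.coe_period, smul_zero, add_zero]
    obtain ⟨hη1, hη2⟩ := abs_le.1 hηle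
    -- The margin `ε * h < x₀ < h - ε * h` keeps the drift from crossing the discontinuity at `0`.
    have hmem : x₀ + i * h + η ∈ Ico 0 L := by
      constructor
      · have : 0 ≤ i * h := by positivity
        linarith
      · have : (i + 1) * h ≤ q * h := by gcongr
        linarith
    rw [hpt, circleCocycle, circleRep_coe hmem]
    refine (abs_cosCutoff_add_sub_le (hηle.trans_lt ?_)).trans (by gcongr)
    have := h1 (k - i)
    rwa [show y - 1 - ((k - i : ℤ) : ℝ) * h = x₀ + i * h - 1 by rw [hx₀]; push_cast; ring] at this
  have hdiff : |birkhoffSum (· + (α : AddCircle L)) circleCocycle q x -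
      ∑ i ∈ Finset.range q, cosCutoff (x₀ + i * h)| ≤ 7 * (ε * L) := by
    rw [← sum_range_emod_eq hq hp k, birkhoffSum, ← Finset.sum_sub_distrib]
    refine (Finset.abs_sum_le_sum_abs _ _).trans ((Finset.sum_le_sum hterm).trans ?_)
    rw [Finset.sum_const, Finset.card_range, nsmul_eq_mul, ← hqh]
    apply le_of_eq
    ring
  refine (abs_sub_le _ _ _).trans ((add_le_add hdiff hm2).trans ?_)
  linarith

/-- The points of `[0, L)` within `ε * L / q` of the lattice `(L / q) ℤ` or of its translate by
`1` form a small set. -/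
theorem le_volume_setOf_lt_abs_sub (hL1 : 1 ≤ L) {ε : ℝ} (hε : 0 ≤ ε) (hε1 : ε ≤ 1) {q : ℕ}
    (hq : 0 < q) {B : Set (AddCircle L)} (hB : MeasurableSet B)
    (h : ∀ x : AddCircle L, (∀ i : ℤ, ε * (L / q) < |circleRep x - i * (L / q)|) →
      (∀ i : ℤ, ε * (L / q) < |circleRep x - 1 - i * (L / q)|) → x ∈ B) :
    ENNReal.ofReal (L - 20 * (ε * L)) ≤ volume B := by
  have hL0 : 0 < L := hL.out
  have hq' : (0 : ℝ) < q := by exact_mod_cast hq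
  have hq1 : (1 : ℝ) ≤ q := by exact_mod_cast hq
  set d := L / q with hd
  have hpos : 0 < d := by positivity
  have hqd : q * d = L := by rw [hd]; field_simp
  -- Both `y` and `y - 1` have absolute value at most `L = q * d`, so only lattice points with index
  -- at most `q + 1` in absolute value can be near.
  set I : Finset ℤ := Finset.Icc (-(q + 1 : ℤ)) (q + 1) with hI
  have hcard : (I.card : ℝ) ≤ 5 * q := by
    have : (I.card : ℤ) = 2 * q + 3 := by
      rw [hI, Int.card_Icc, Int.toNat_of_nonneg (by omega)]; ring
    have : (I.card : ℝ) = 2 * q + 3 := by exact_mod_cast this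
    linarith
  have hIbig : ∀ (z : ℝ) (i : ℤ), |z| ≤ L → |z - i * d| ≤ ε * d → i ∈ I := by
    intro z i hz hi
    obtain ⟨hz1, hz2⟩ := abs_le.1 hz
    obtain ⟨hi1, hi2⟩ := abs_le.1 hi
    have hεd : ε * d ≤ d := by nlinarith
    rw [hI, Finset.mem_Icc]
    constructor
    · have : ((-(q + 1) : ℤ) : ℝ) * d ≤ i * d := by push_cast; linarith
      exact_mod_cast le_of_mul_le_mul_right this hpos
    · have : (i : ℝ) * d ≤ ((q + 1 : ℤ) : ℝ) * d := by push_cast; linarith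
      exact_mod_cast le_of_mul_le_mul_right this hpos
  let N : ℝ → Set ℝ := fun s => ⋃ i ∈ I, Metric.closedBall (s + i * d) (ε * d)
  have hN : ∀ s, volume (N s) ≤ ENNReal.ofReal (10 * (ε * L)) := by
    intro s
    refine (measure_biUnion_finset_le I _).trans ?_
    simp only [Real.volume_closedBall, Finset.sum_const, nsmul_eq_mul]
    rw [← ENNReal.ofReal_natCast, ← ENNReal.ofReal_mul (by positivity)]
    refine ENNReal.ofReal_le_ofReal ?_
    calc (I.card : ℝ) * (2 * (ε * d)) ≤ 5 * q * (2 * (ε * d)) := by gcongr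
      _ = 10 * (ε * L) := by rw [← hqd]; ring
  have hsub : Ioo 0 L ⊆ ((QuotientAddGroup.mk ⁻¹' B ∩ Ioc 0 (0 + L)) ∪ N 0) ∪ N 1 := by
    intro y hy
    have hrep : circleRep (y : AddCircle L) = y := circleRep_coe ⟨hy.1.le, hy.2⟩
    by_contra hc
    simp only [mem_union, not_or] at hc
    refine hc.1.1 ⟨h _ (fun i => ?_) (fun i => ?_), hy.1, by simpa using hy.2.le⟩
    · rw [hrep]
      by_contra hi
      refine hc.1.2 (mem_iUnion₂.2 ⟨i, hIbig y i ?_ (not_lt.1 hi), ?_⟩)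
      · rw [abs_of_pos hy.1]; exact hy.2.le
      · simpa [Real.dist_eq] using not_lt.1 hi
    · rw [hrep]
      by_contra hi
      refine hc.2 (mem_iUnion₂.2 ⟨i, hIbig (y - 1) i ?_ (not_lt.1 hi), ?_⟩)
      · rw [abs_le]; constructor <;> linarith [hy.1, hy.2]
      · simpa [Real.dist_eq, sub_sub] using not_lt.1 hi
  have hle : ENNReal.ofReal L ≤ volume B + ENNReal.ofReal (20 * (ε * L)) := by
    calc ENNReal.ofReal L = volume (Ioo 0 L) := by simp
      _ ≤ volume (QuotientAddGroup.mk ⁻¹' B ∩ Ioc 0 (0 + L)) + volume (N 0) + volume (N 1) :=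
        (measure_mono hsub).trans ((measure_union_le _ _).trans
          (add_le_add (measure_union_le _ _) le_rfl))
      _ ≤ volume B + ENNReal.ofReal (10 * (ε * L)) + ENNReal.ofReal (10 * (ε * L)) := by
        rw [AddCircle.add_projection_respects_measure L 0 hB]
        gcongr <;> apply hN
      _ = volume B + ENNReal.ofReal (20 * (ε * L)) := by
        rw [add_assoc, ← ENNReal.ofReal_add (by positivity) (by positivity)]
        ring_nf
  rw [ENNReal.ofReal_sub _ (by positivity)]
  exact tsub_le_iff_right.2 hle

end Circle

/-! ### Essential values and ergodicity for the rotation -/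

section Circle

variable {L : ℝ} [hL : Fact (0 < L)]

theorem dist_iterate_add_right_le {α ε : ℝ} {q : ℕ} {p : ℤ} (hq : 0 < q)
    (hα : |α / L - p / q| ≤ ε * (1 / (q : ℝ) ^ 2)) (x : AddCircle L) :
    dist ((· + (α : AddCircle L))^[q] x) x ≤ ε * (L / q) := by
  have hL0 : 0 < L := hL.out
  have hq' : (0 : ℝ) < q := by exact_mod_cast hq
  have h1 : q • (α : AddCircle L) = ((q * α - p * L : ℝ) : AddCircle L) := by
    rw [AddCircle.coe_sub, ← zsmul_eq_mul, AddCircle.coe_zsmul, AddCircle.coe_period, smul_zero,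
      sub_zero, ← nsmul_eq_mul, AddCircle.coe_nsmul]
  rw [add_right_iterate]
  beta_reduce
  rw [dist_eq_norm, add_sub_cancel_left, h1, AddCircle.norm_eq]
  have h2 := round_le (L⁻¹ * (q * α - p * L)) 0
  have h3 : ∀ n : ℤ, |q * α - p * L - n * L| = L * |L⁻¹ * (q * α - p * L) - n| := fun n => by
    conv_rhs => rw [← abs_of_pos hL0, ← abs_mul, abs_of_pos hL0]
    congr 1
    field_simp
  have h4 : |q * α - p * L| = q * L * |α / L - p / q| := by
    conv_rhs => rw [← abs_of_pos (mul_pos hq' hL0), ← abs_mul]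
    congr 1
    field_simp
  calc _ = L * |L⁻¹ * (q * α - p * L) - round (L⁻¹ * (q * α - p * L))| := h3 _
    _ ≤ L * |L⁻¹ * (q * α - p * L) - (0 : ℤ)| := by gcongr
    _ = |q * α - p * L| := by rw [← h3]; simp
    _ = q * L * |α / L - p / q| := h4
    _ ≤ q * L * (ε * (1 / (q : ℝ) ^ 2)) := by gcongr
    _ = ε * (L / q) := by field_simp

/-- If `q / L` is close to `N + c`, an integer within one of `q / L` is `N` or `N + 1`, so the
Birkhoff sum is close to `-c` or `1 - c` on a set of measure at least `L / 2`. One of the two values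
therefore takes at least `L / 4`. -/
theorem isRigidEssentialValue_neg_or_one_sub (hL1 : 1 ≤ L) {α c : ℝ} (hc : c ∈ Ioo (0 : ℝ) 1)
    (h : ∀ (ε : ℝ) (K : ℕ), 0 < ε → HasApproximation (α / L) (1 / L) c ε K) :
    IsRigidEssentialValue (volume : Measure (AddCircle L)) (· + (α : AddCircle L))
        circleCocycle (-c) ∨
      IsRigidEssentialValue (volume : Measure (AddCircle L)) (· + (α : AddCircle L))
        circleCocycle (1 - c) := by
  have hL0 : 0 < L := hL.out
  set R : AddCircle L → AddCircle L := (· + (α : AddCircle L)) with hR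
  have hRm : Measurable R := measurable_add_const _
  let B : ℕ → ℝ → ℝ → Set (AddCircle L) := fun n a ε =>
    {x | dist (R^[n] x) x < ε ∧ |birkhoffSum R circleCocycle n x - a| < ε}
  have hBm : ∀ n a ε, MeasurableSet (B n a ε) := by
    intro n a ε
    have hS : Measurable (birkhoffSum R circleCocycle n) :=
      Finset.measurable_fun_sum _ fun i _ => measurable_circleCocycle.comp (hRm.iterate i)
    refine MeasurableSet.inter ?_ ?_
    · exact measurableSet_lt ((hRm.iterate n).dist measurable_id) measurable_const
    · exact measurableSet_lt (hS.sub_const a).norm measurable_const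
  have hmono : ∀ n a {ε ε' : ℝ}, ε ≤ ε' → B n a ε ⊆ B n a ε' := fun n a ε ε' hε x hx =>
    ⟨hx.1.trans_le hε, hx.2.trans_le hε⟩
  have key : ∀ ε : ℝ, 0 < ε → ∃ n, ENNReal.ofReal (L / 4) ≤ volume (B n (-c) ε) ∨
      ENNReal.ofReal (L / 4) ≤ volume (B n (1 - c) ε) := by
    intro ε hε
    obtain ⟨hc0, hc1⟩ := hc
    -- The bounds `c` and `1 - c` force `m - N ∈ {0, 1}`, `1 / 40` keeps half of the circle, and `ε
    -- / (17 + 7 * L)` absorbs all errors.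
    set δ := min (min c (1 - c)) (min (1 / 40) (min (ε / (17 + 7 * L)) 1)) with hδ
    have hδ0 : 0 < δ := by
      have : 0 < 1 - c := by linarith
      positivity
    have hδc : δ ≤ c := (min_le_left _ _).trans (min_le_left _ _)
    have hδc1 : δ ≤ 1 - c := (min_le_left _ _).trans (min_le_right _ _)
    have hδ40 : δ ≤ 1 / 40 := (min_le_right _ _).trans (min_le_left _ _)
    have hδε : δ * (17 + 7 * L) ≤ ε := by
      rw [← le_div_iff₀ (by positivity)]
      exact (min_le_right _ _).trans ((min_le_right _ _).trans (min_le_left _ _))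
    obtain ⟨K, hK⟩ := exists_nat_gt (4 * L / δ)
    have hK0 : (0 : ℝ) < K := lt_trans (by positivity) hK
    obtain ⟨q, hKq, p, N, hp, hpq, hN⟩ := h δ K hδ0
    have hKq' : (K : ℝ) ≤ q := by exact_mod_cast hKq
    have hq' : (0 : ℝ) < q := hK0.trans_le hKq'
    have hq : 0 < q := by exact_mod_cast hq'
    have hLq : 4 * (L / q) ≤ δ := by
      rw [← mul_div_assoc, div_le_iff₀ hq']
      rw [div_lt_iff₀ hδ0] at hK
      nlinarith
    have hLq0 : 0 < L / q := by positivity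
    refine ⟨q, ?_⟩
    have hU := le_volume_setOf_lt_abs_sub (B := B q (-c) ε ∪ B q (1 - c) ε) hL1 hδ0.le
      (by linarith) hq ((hBm _ _ _).union (hBm _ _ _)) (by
        intro x h0 h1
        obtain ⟨m, hm1, hm2⟩ := exists_abs_birkhoffSum_circleCocycle_sub_le hL1 hq hp hpq.le
          (by nlinarith [Real.pi_lt_four]) h0 h1
        have hd : dist (R^[q] x) x < ε := by
          refine (dist_iterate_add_right_le hq hpq.le x).trans_lt ?_
          nlinarith
        rw [mul_one_div] at hN
        obtain ⟨hN1, hN2⟩ := abs_lt.1 hN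
        obtain ⟨hm3, hm4⟩ := abs_le.1 hm1
        obtain ⟨hm5, hm6⟩ := abs_le.1 hm2
        have hmN0 : (-1 : ℝ) < ((m - N : ℤ) : ℝ) := by push_cast; linarith
        have hmN1 : ((m - N : ℤ) : ℝ) < 2 := by push_cast; linarith
        have hmN0' : -1 < (m - N : ℤ) := by exact_mod_cast hmN0
        have hmN1' : (m - N : ℤ) < 2 := by exact_mod_cast hmN1
        have hcases : (m - N : ℤ) = 0 ∨ (m - N : ℤ) = 1 := by omega
        have hεb : 15 * (L / q) + 7 * (δ * L) + δ < ε := by nlinarith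
        rcases hcases with hz | hz
        · have hz' : (m : ℝ) = N := by exact_mod_cast sub_eq_zero.1 hz
          refine Or.inl ⟨hd, ?_⟩
          rw [abs_lt]
          constructor <;> linarith
        · have hz' : (m : ℝ) = N + 1 := by
            have : (m : ℤ) = N + 1 := by omega
            exact_mod_cast this
          refine Or.inr ⟨hd, ?_⟩
          rw [abs_lt]
          constructor <;> linarith)
    by_contra hcon
    simp only [not_or, not_le] at hcon
    have hlt : volume (B q (-c) ε ∪ B q (1 - c) ε) < ENNReal.ofReal (L / 2) := by
      refine (measure_union_le _ _).trans_lt ((ENNReal.add_lt_add hcon.1 hcon.2).trans_eq ?_)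
      rw [← ENNReal.ofReal_add (by positivity) (by positivity)]
      ring_nf
    refine absurd (hU.trans_lt hlt) (not_lt.2 (ENNReal.ofReal_le_ofReal ?_))
    nlinarith
  have hne : ENNReal.ofReal (L / 4) ≠ 0 := by
    rw [Ne, ENNReal.ofReal_eq_zero, not_le]; positivity
  -- Which value wins may depend on `ε`; if each failed at some scale, both would fail at the
  -- smaller scale.
  by_contra hcon
  simp only [IsRigidEssentialValue, not_or, not_exists, not_and, not_forall] at hcon
  obtain ⟨ε₁, hε₁, h₁⟩ := hcon.1 _ hne
  obtain ⟨ε₂, hε₂, h₂⟩ := hcon.2 _ hne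
  obtain ⟨n, hn | hn⟩ := key (min ε₁ ε₂) (lt_min hε₁ hε₂)
  · obtain ⟨x, hx, hx'⟩ := h₁ n _ (hBm n _ ε₁)
      (hn.trans (measure_mono (hmono _ _ (min_le_left _ _))))
    exact hx' hx.1 hx.2
  · obtain ⟨x, hx, hx'⟩ := h₂ n _ (hBm n _ ε₂)
      (hn.trans (measure_mono (hmono _ _ (min_le_right _ _))))
    exact hx' hx.1 hx.2

/-- Were the essential values countable, their preimages under `c ↦ -c` and `c ↦ 1 - c` would be
too, yet these cover `(0, 1)`. -/
theorem ergodic_realExtension_circleCocycle (hL1 : 1 ≤ L) {α : ℝ} (hα : Irrational (α / L))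
    (h : ∀ (c ε : ℝ) (K : ℕ), 0 < ε → HasApproximation (α / L) (1 / L) c ε K) :
    Ergodic (realExtension (· + (α : AddCircle L)) circleCocycle)
      ((volume : Measure (AddCircle L)).prod (volume : Measure ℝ)) := by
  have hR : Ergodic (· + (α : AddCircle L)) (volume : Measure (AddCircle L)) := by
    rw [AddCircle.ergodic_add_right, ← AddCircle.denseRange_zsmul_iff,
      AddCircle.denseRange_zsmul_coe_iff]
    exact hα
  refine ergodic_realExtension hR measurable_circleCocycle fun hS => ?_
  have hsub : Ioo (0 : ℝ) 1 ⊆ Neg.neg ⁻¹' {a | IsRigidEssentialValue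
      (volume : Measure (AddCircle L)) (· + (α : AddCircle L)) circleCocycle a} ∪
      (fun c => 1 - c) ⁻¹' {a | IsRigidEssentialValue
      (volume : Measure (AddCircle L)) (· + (α : AddCircle L)) circleCocycle a} :=
    fun c hc => isRigidEssentialValue_neg_or_one_sub hL1 hc (h c)
  have hcount : (Ioo (0 : ℝ) 1).Countable :=
    ((hS.preimage neg_injective).union (hS.preimage sub_right_injective)).mono hsub
  have h0 : volume (Ioo (0 : ℝ) 1) = 0 := hcount.measure_zero volume
  simp at h0

end Circle

/-! ### From the rotation to the interval exchange -/

section Transfer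

open IET

theorem symmThreeIET_apply (a b x : ℝ) : symmThreeIET ![a, b, 1 - a - b] x =
    x + ((Ico 0 a).indicator (fun _ => 1 - a) x +
      (Ico a (a + b)).indicator (fun _ => 1 - a - b - a) x +
      (Ico (a + b) 1).indicator (fun _ => -(a + b)) x) := by
  have h2 : leftEnd ![a, b, 1 - a - b] (Equiv.refl (Fin 3)) 2 = a + b := by
    rw [leftEnd, Finset.sum_filter, Fin.sum_univ_three]
    simp [Fin.lt_def]
  rw [symmThreeIET, iet, Fin.sum_univ_three]
  simp only [interval, h2]
  simp [leftEnd, Finset.sum_filter, Fin.sum_univ_three]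

variable {a b x : ℝ}

theorem symmThreeIET_of_lt (hb : 0 < b) (h0 : 0 ≤ x) (h : x < a) :
    symmThreeIET ![a, b, 1 - a - b] x = x + (1 - a) := by
  rw [symmThreeIET_apply, indicator_of_mem (mem_Ico.2 ⟨h0, h⟩), indicator_of_notMem, indicator_of_notMem]
  · ring
  · exact fun hx => by linarith [hx.1]
  · exact fun hx => by linarith [hx.1]

theorem symmThreeIET_of_mem_Ico (hx : x ∈ Ico a (a + b)) :
    symmThreeIET ![a, b, 1 - a - b] x = x + (1 - a - b - a) := by
  rw [symmThreeIET_apply, indicator_of_notMem, indicator_of_mem hx, indicator_of_notMem]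
  · ring
  · exact fun h => by linarith [hx.2, h.1]
  · exact fun h => by linarith [hx.1, h.2]

theorem symmThreeIET_of_le (hb : 0 < b) (h : a + b ≤ x) (h1 : x < 1) :
    symmThreeIET ![a, b, 1 - a - b] x = x - (a + b) := by
  rw [symmThreeIET_apply, indicator_of_notMem, indicator_of_notMem, indicator_of_mem (mem_Ico.2 ⟨h, h1⟩)]
  · ring
  · exact fun hx => by linarith [hx.2]
  · exact fun hx => by linarith [hx.2]

theorem measurable_symmThreeIET (a b : ℝ) : Measurable (symmThreeIET ![a, b, 1 - a - b]) := by
  have : symmThreeIET ![a, b, 1 - a - b] = fun x =>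
    x + ((Ico 0 a).indicator (fun _ => 1 - a) x +
      (Ico a (a + b)).indicator (fun _ => 1 - a - b - a) x +
      (Ico (a + b) 1).indicator (fun _ => -(a + b)) x) := funext (symmThreeIET_apply a b)
  rw [this]
  exact measurable_id.add (((measurable_const.indicator measurableSet_Ico).add
    (measurable_const.indicator measurableSet_Ico)).add
    (measurable_const.indicator measurableSet_Ico))

theorem volume_restrict_Ico_add {u v w : ℝ} (huv : u ≤ v) (hvw : v ≤ w) {s : Set ℝ}
    (hs : MeasurableSet s) :
    volume (s ∩ Ico u w) = volume (s ∩ Ico u v) + volume (s ∩ Ico v w) := by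
  rw [← Ico_union_Ico_eq_Ico huv hvw, inter_union_distrib_left, measure_union _
    (hs.inter measurableSet_Ico)]
  exact (Ico_disjoint_Ico_same).mono inter_subset_right inter_subset_right

theorem volume_preimage_inter_Ico_of_eq_add {T : ℝ → ℝ} {u v c : ℝ}
    (hT : ∀ x ∈ Ico u v, T x = x + c) (s : Set ℝ) :
    volume (T ⁻¹' s ∩ Ico u v) = volume (s ∩ Ico (u + c) (v + c)) := by
  rw [← measure_preimage_add_right volume c (s ∩ Ico (u + c) (v + c))]
  congr 1
  ext x
  simp only [mem_inter_iff, mem_preimage, mem_Ico, add_le_add_iff_right, add_lt_add_iff_right]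
  exact and_congr_left fun hx => by rw [hT x hx]

theorem measurePreserving_symmThreeIET (ha : 0 < a) (hb : 0 < b) (hab : a + b < 1) :
    MeasurePreserving (symmThreeIET ![a, b, 1 - a - b]) (volume.restrict (Ico (0 : ℝ) 1))
      (volume.restrict (Ico (0 : ℝ) 1)) := by
  have hT := measurable_symmThreeIET a b
  refine ⟨hT, Measure.ext fun s hs => ?_⟩
  have hTs := hT hs
  rw [Measure.map_apply hT hs, Measure.restrict_apply hTs, Measure.restrict_apply hs,
    volume_restrict_Ico_add (v := a) ha.le (by linarith) hTs,
    volume_restrict_Ico_add (u := a) (v := a + b) (by linarith) hab.le hTs,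
    volume_preimage_inter_Ico_of_eq_add (fun x hx => symmThreeIET_of_lt hb hx.1 hx.2),
    volume_preimage_inter_Ico_of_eq_add (fun x hx => symmThreeIET_of_mem_Ico hx),
    volume_preimage_inter_Ico_of_eq_add (c := -(a + b))
      (fun x hx => by rw [symmThreeIET_of_le hb hx.1 hx.2, sub_eq_add_neg]),
    volume_restrict_Ico_add (u := 0) (v := 1 - a - b) (w := 1) (by linarith) (by linarith) hs,
    volume_restrict_Ico_add (u := 1 - a - b) (v := 1 - a) (by linarith) (by linarith) hs]
  rw [show a + (1 - a - b - a) = 1 - a - b by ring, show a + b + (1 - a - b - a) = 1 - a by ring,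
    show 0 + (1 - a) = 1 - a by ring, show a + (1 - a) = 1 by ring,
    show a + b + -(a + b) = 0 by ring, show 1 + -(a + b) = 1 - a - b by ring]
  ring

theorem measurePreserving_skewProduct_symmThreeIET (ha : 0 < a) (hb : 0 < b) (hab : a + b < 1)
    {f : ℝ → ℝ} (hf : Measurable f) :
    MeasurePreserving (skewProduct (symmThreeIET ![a, b, 1 - a - b]) f)
      ((volume.restrict (Ico (0 : ℝ) 1)).prod volume)
      ((volume.restrict (Ico (0 : ℝ) 1)).prod volume) :=
  measurePreserving_realExtension (measurePreserving_symmThreeIET ha hb hab) hf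

/-- The first entrance into `[0, 1)` of the rotation by `1 - a` on the circle of length `1 + b`,
in terms of representatives in `[0, 1 + b)`. -/
noncomputable def entrance (a b y : ℝ) : ℝ := if y < 1 then y else y - (a + b)

theorem measurable_entrance (a b : ℝ) : Measurable (entrance a b) :=
  Measurable.ite measurableSet_Iio measurable_id (measurable_id.sub_const _)

variable [hL : Fact (0 < 1 + b)]

/-- The entrance map semiconjugates the extended rotation to the skew product over the interval
exchange on the part over `[0, 1)`, and is constant along it elsewhere. -/
theorem entrance_circleRep_add (ha : 0 < a) (hb : 0 < b) (hab : a + b < 1)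
    (x : AddCircle (1 + b)) :
    entrance a b (circleRep (x + ((1 - a : ℝ) : AddCircle (1 + b)))) =
      if circleRep x < 1 then symmThreeIET ![a, b, 1 - a - b] (circleRep x)
      else entrance a b (circleRep x) := by
  obtain ⟨h0, h1⟩ := circleRep_mem x
  conv_lhs => rw [← coe_circleRep x]
  set y := circleRep x
  rw [← AddCircle.coe_add]
  rcases lt_or_ge y (a + b) with hy | hy
  · rw [circleRep_coe ⟨by linarith, by linarith⟩, if_pos (by linarith), entrance]
    rcases lt_or_ge y a with hya | hya
    · rw [if_pos (by linarith), symmThreeIET_of_lt hb h0 hya]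
    · rw [if_neg (by linarith), symmThreeIET_of_mem_Ico ⟨hya, hy⟩]
      ring
  · rw [circleRep_coe_sub ⟨by linarith, by linarith⟩, entrance, if_pos (by linarith)]
    split_ifs with hy1
    · rw [symmThreeIET_of_le hb hy hy1]
      ring
    · rw [entrance, if_neg hy1]
      ring

/-- An invariant set pulls back along the entrance map to a set invariant under the extended
rotation: over `[1, 1 + b)` the cocycle vanishes and the entrance point does not change. Over `[0,
1)` the pullback is the original set. -/
theorem ergodic_skewProduct_of_ergodic_realExtension (ha : 0 < a) (hb : 0 < b) (hab : a + b < 1)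
    (h : Ergodic (realExtension (· + ((1 - a : ℝ) : AddCircle (1 + b))) circleCocycle)
      ((volume : Measure (AddCircle (1 + b))).prod (volume : Measure ℝ))) :
    Ergodic (skewProduct (symmThreeIET ![a, b, 1 - a - b])
        (fun x => Real.cos (2 * Real.pi * x)))
      ((volume.restrict (Ico (0 : ℝ) 1)).prod (volume : Measure ℝ)) := by
  refine ⟨measurePreserving_skewProduct_symmThreeIET ha hb hab (by fun_prop),
    ⟨fun s hs hinv => ?_⟩⟩
  let π : AddCircle (1 + b) × ℝ → ℝ × ℝ := fun p => (entrance a b (circleRep p.1), p.2)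
  have hπ : Measurable π :=
    ((measurable_entrance a b).comp (measurable_circleRep.comp measurable_fst)).prodMk
      measurable_snd
  have hD : realExtension (· + ((1 - a : ℝ) : AddCircle (1 + b))) circleCocycle ⁻¹' (π ⁻¹' s) =
      π ⁻¹' s := by
    ext ⟨x, t⟩
    simp only [mem_preimage, realExtension, π, entrance_circleRep_add ha hb hab, circleCocycle,
      cosCutoff]
    split_ifs with hx
    · rw [entrance, if_pos hx]
      conv_rhs => rw [← hinv]
      rfl
    · rw [add_zero]
  have hconst := h.toPreErgodic.aeconst_set (hπ hs) hD
  have hmk : MeasurePreserving ((↑) : ℝ → AddCircle (1 + b))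
      (volume.restrict (Ico (0 : ℝ) (1 + b))) := by
    have := AddCircle.measurePreserving_mk (1 + b) 0
    rwa [zero_add, ← Measure.restrict_congr_set Ico_ae_eq_Ioc] at this
  have hι := (hmk.prod (MeasurePreserving.id (volume : Measure ℝ))).quasiMeasurePreserving
  have hle : (volume.restrict (Ico (0 : ℝ) 1)).prod (volume : Measure ℝ) ≤
      (volume.restrict (Ico (0 : ℝ) (1 + b))).prod volume :=
    Measure.prod_mono (Measure.restrict_mono (Ico_subset_Ico_right (by linarith)) le_rfl) le_rfl
  have hmem : ∀ᵐ p ∂((volume.restrict (Ico (0 : ℝ) 1)).prod (volume : Measure ℝ)),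
      p.1 ∈ Ico (0 : ℝ) 1 :=
    Measure.quasiMeasurePreserving_fst.ae (ae_restrict_mem measurableSet_Ico)
  have hrep : ∀ p : ℝ × ℝ, p.1 ∈ Ico (0 : ℝ) 1 →
      (Prod.map ((↑) : ℝ → AddCircle (1 + b)) id p ∈ π ⁻¹' s ↔ p ∈ s) := by
    rintro ⟨y, t⟩ hy
    simp only [mem_preimage, π, Prod.map, id]
    rw [circleRep_coe ⟨hy.1, by linarith [hy.2]⟩, entrance, if_pos hy.2]
  rw [eventuallyConst_set] at hconst ⊢
  refine hconst.imp (fun hc => ?_) (fun hc => ?_)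
  · filter_upwards [hmem, ae_mono hle (hι.ae hc)] with p hp hp'
    exact (hrep p hp).1 hp'
  · filter_upwards [hmem, ae_mono hle (hι.ae hc)] with p hp hp'
    exact mt (hrep p hp).2 hp'

end Transfer

/-! ### Almost every length vector -/

/-- Null sets pull back to null sets under `(a, b) ↦ ((1 - a) / (1 + b), 1 / (1 + b))`. -/
theorem ae_div_one_add {P : ℝ × ℝ → Prop} (h : ∀ᵐ x : ℝ × ℝ, P x) :
    ∀ᵐ p : ℝ × ℝ, 0 < p.2 → P ((1 - p.1) / (1 + p.2), 1 / (1 + p.2)) := by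
  -- The inverse change of parameters, differentiable where the second coordinate is nonzero, so it
  -- carries null sets there to null sets.
  let ψ : ℝ × ℝ → ℝ × ℝ := fun x => (1 - x.1 / x.2, 1 / x.2 - 1)
  have hψ : DifferentiableOn ℝ ψ ({x | ¬ P x} ∩ {x | x.2 ≠ 0}) := by
    intro x hx
    have hx2 : x.2 ≠ 0 := hx.2
    refine DifferentiableAt.differentiableWithinAt ?_
    exact DifferentiableAt.prodMk (by fun_prop (disch := exact hx2))
      (by fun_prop (disch := exact hx2))
  have h0 : volume ({x | ¬ P x} ∩ {x : ℝ × ℝ | x.2 ≠ 0}) = 0 :=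
    measure_mono_null inter_subset_left h
  have h1 := addHaar_image_eq_zero_of_differentiableOn_of_addHaar_eq_zero volume hψ h0
  filter_upwards [measure_eq_zero_iff_ae_notMem.1 h1] with p hp hp2
  by_contra hc
  have hne : 1 + p.2 ≠ 0 := by linarith
  refine hp ⟨_, ⟨hc, one_div_ne_zero hne⟩, ?_⟩
  ext
  · simp only [ψ]; field_simp; ring
  · simp only [ψ]; field_simp; ring

/-- For Lebesgue almost every length vector `(a, b, 1 - a - b)` in the open unit simplex, the skew
product of the symmetric 3-IET on `[0,1)` by `cos (2πx)` is ergodic for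
`Leb_[0,1) ⊗ Leb_ℝ`. -/
theorem mainTheorem4 :
    ∀ᵐ p : ℝ × ℝ, 0 < p.1 → 0 < p.2 → p.1 + p.2 < 1 →
      Ergodic
        (IET.skewProduct (IET.symmThreeIET ![p.1, p.2, 1 - p.1 - p.2])
          (fun x => Real.cos (2 * Real.pi * x)))
        ((volume.restrict (Ico (0 : ℝ) 1)).prod (volume : Measure ℝ)) := by
  have hirr : ∀ᵐ x : ℝ × ℝ, Irrational x.1 :=
    Measure.quasiMeasurePreserving_fst.ae ((countable_range ((↑) : ℚ → ℝ)).ae_notMem volume)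
  filter_upwards [ae_div_one_add (hirr.and ae_forall_hasApproximation)] with p hp ha hb hab
  have : Fact (0 < 1 + p.2) := ⟨by linarith⟩
  obtain ⟨h1, h2⟩ := hp hb
  exact ergodic_skewProduct_of_ergodic_realExtension ha hb hab
    (ergodic_realExtension_circleCocycle (by linarith) h1 h2)
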